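/- Let $k>1$ be an integer and let $G$ be a simple graph (no loops or parallel edges) on $n\ge 1$ vertices. Let $c:E(G)\to\{1,\dots,n\}$ be a colouring of the edges of $G$, not necessarily proper, such that $|c^{-1}(i)|\ge 301\,k\log_2 k$ for every $i\in\{1,\dots,n\}$. Then $G$ contains a rainbow cycle of length at most $\lceil n/k\rceil$, that is, a cycle $C$ in $G$ of length at most $\lceil n/k\rceil$ such that $c(e)\ne c(f)$ for any two distinct edges $e,f$ of $C$. -/

import Mathlib

/-- A closed walk `p` of `G` is a rainbow cycle with respect to the edge colouring `c` if it is a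
cycle and any two distinct edges of it have distinct colours. -/
def SimpleGraph.Walk.IsRainbowCycle {V α : Type*} {G : SimpleGraph V} {v : V}
    (p : G.Walk v v) (c : G.edgeSet → α) : Prop :=
  p.IsCycle ∧
    ∀ e f : G.edgeSet, (e : Sym2 V) ∈ p.edges → (f : Sym2 V) ∈ p.edges → e ≠ f → c e ≠ c f

/-!
It suffices to find a nonempty set `S` of at most `n / k` vertices inside which at least `#S`
colours have an edge: one edge of each of these colours gives a graph on `S` with at least as many
edges as vertices, so it contains a cycle, which is rainbow and has length at most `#S`.

Call `v` a centre of a colour if at least `60 k log₂ k` edges of that colour meet at `v`, and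
choose a set `W` of centres of distinct colours that contains a centre of every colour that has
one.

If at most `n / (8 k)` vertices lie outside `W`, let `S` consist of these vertices, both ends of
one edge from each of as many colours not chosen for `W`, and a set of at most `n / (2 k)`
vertices meeting the star at every `v ∈ W`. Every vertex of `S` in `W` then contributes its own
colour, and the other colours make up for the vertices of `S` outside `W`.

Otherwise, let `S` be random, containing the vertices of `W` with probability `q = 1 / (4 k)` and
the others with probability `3 q / 4`. A colour has an edge inside `S` with probability almost
`q`: if it has a centre in `W`, because `S` is likely to meet the star there, and if all its
degrees are small, by the second moment method. The expected number of these colours exceeds the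
expected size of `S`, and still does so after discarding the unlikely event `n / k ≤ #S`.
-/

open Finset

section RainbowCycle

variable {V α : Type*} {G : SimpleGraph V}

lemma card_edgeSet_lt_of_isAcyclic [Finite V] [Nonempty V] (hG : G.IsAcyclic) :
    Nat.card G.edgeSet < Nat.card V := by
  obtain ⟨T, hGT, -, hT⟩ :=
    (SimpleGraph.connected_top (V := V)).exists_isTree_le_of_le_of_isAcyclic le_top hG
  have hcard := (SimpleGraph.isTree_iff_connected_and_card.mp hT).2
  have hle : Nat.card G.edgeSet ≤ Nat.card T.edgeSet :=
    Nat.card_mono (Set.toFinite _) (SimpleGraph.edgeSet_mono hGT)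
  omega

lemma exists_isCycle_length_le_card [Finite V] {S : Finset V} (hS : S.Nonempty)
    (hGS : G.support ⊆ S) (hcard : #S ≤ G.edgeSet.ncard) :
    ∃ (v : V) (p : G.Walk v v), p.IsCycle ∧ p.length ≤ #S := by
  classical
  have := Fintype.ofFinite V
  have : Nonempty (S : Set V) := hS.to_subtype
  have hcyclic : ¬ (G.induce (S : Set V)).IsAcyclic := by
    intro h
    refine (card_edgeSet_lt_of_isAcyclic h).not_ge ?_
    calc Nat.card (S : Set V) = #S := Set.ncard_coe_finset S
      _ ≤ G.edgeSet.ncard := hcard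
      _ = #G.edgeFinset := by rw [← SimpleGraph.coe_edgeFinset, Set.ncard_coe_finset]
      _ = Nat.card (G.induce (S : Set V)).edgeSet := by
        rw [← SimpleGraph.card_edgeFinset_induce_of_support_subset hGS, ← Set.ncard_coe_finset,
          SimpleGraph.coe_edgeFinset, Nat.card_coe_set_eq]
  simp only [SimpleGraph.IsAcyclic, not_forall, not_not] at hcyclic
  obtain ⟨v, p, hp⟩ := hcyclic
  let φ := (SimpleGraph.Embedding.induce (G := G) (S : Set V)).toHom
  refine ⟨φ v, p.map φ, hp.map Subtype.val_injective, ?_⟩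
  simpa using hp.support_nodup.length_le_card

lemma exists_le_injOn_color_of_forall_exists_mem (c : G.edgeSet → α) {S : Finset V} {I : Finset α}
    (hI : ∀ i ∈ I, ∃ e : G.edgeSet, c e = i ∧ (e : Sym2 V) ∈ S.sym2) :
    ∃ K ≤ G, K.support ⊆ S ∧ K.edgeSet.ncard = #I ∧
      Set.InjOn c {e | (e : Sym2 V) ∈ K.edgeSet} := by
  choose e hce heS using hI
  let edge (i : I) : Sym2 V := e i i.2
  have hedge_injective : Function.Injective edge := fun i j hij ↦ Subtype.ext <| by
    rw [← hce i i.2, ← hce j j.2, Subtype.ext hij]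
  have hKedge : (SimpleGraph.fromEdgeSet (Set.range edge)).edgeSet = Set.range edge := by
    rw [SimpleGraph.edgeSet_fromEdgeSet, sdiff_eq_left, Set.disjoint_left]
    rintro _ ⟨i, rfl⟩
    exact G.not_isDiag_of_mem_edgeSet (e i i.2).2
  refine ⟨.fromEdgeSet (Set.range edge), ?_, fun u hu ↦ ?_, ?_, ?_⟩
  · rw [← SimpleGraph.edgeSet_subset_edgeSet, hKedge]
    rintro _ ⟨i, rfl⟩
    exact (e i i.2).2
  · obtain ⟨v, huv⟩ := (SimpleGraph.mem_support _).mp hu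
    rw [← SimpleGraph.mem_edgeSet, hKedge] at huv
    obtain ⟨i, hi⟩ := huv
    have huvS : s(u, v) ∈ S.sym2 := hi ▸ (heS i i.2 : edge i ∈ S.sym2)
    exact (mk_mem_sym2_iff.mp huvS).1
  · rw [hKedge, ← Set.image_univ, Set.ncard_image_of_injective _ hedge_injective, Set.ncard_univ,
      Nat.card_eq_fintype_card, Fintype.card_coe]
  · rw [hKedge]
    rintro f ⟨i, hi⟩ f' ⟨j, hj⟩ hc
    obtain rfl : e i i.2 = f := Subtype.ext hi
    obtain rfl : e j j.2 = f' := Subtype.ext hj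
    rw [hce, hce] at hc
    rw [Subtype.ext hc]

lemma exists_isRainbowCycle_length_le_card [Finite V] (c : G.edgeSet → α) {S : Finset V}
    (hS : S.Nonempty) {I : Finset α} (hSI : #S ≤ #I)
    (hI : ∀ i ∈ I, ∃ e : G.edgeSet, c e = i ∧ (e : Sym2 V) ∈ S.sym2) :
    ∃ (v : V) (p : G.Walk v v), p.IsRainbowCycle c ∧ p.length ≤ #S := by
  obtain ⟨K, hKG, hKS, hcard, hc⟩ := exists_le_injOn_color_of_forall_exists_mem c hI
  obtain ⟨v, p, hp, hpS⟩ := exists_isCycle_length_le_card hS hKS (hcard ▸ hSI)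
  have hpK {e : Sym2 V} (he : e ∈ (p.mapLe hKG).edges) : e ∈ K.edgeSet := by
    rw [SimpleGraph.Walk.edges_mapLe_eq_edges] at he
    exact p.edges_subset_edgeSet he
  exact ⟨v, p.mapLe hKG,
    ⟨hp.mapLe hKG, fun f f' hf hf' hne hff' ↦ hne (hc (hpK hf) (hpK hf') hff')⟩, by simpa using hpS⟩

end RainbowCycle

section BernoulliSubset

variable {V : Type*} [Fintype V] [DecidableEq V] {p : V → ℝ}

/-- The expectation of `f S`, where the random set `S` contains each vertex `v` independently with
probability `p v`. -/
noncomputable def bernoulliExp (p : V → ℝ) : (Finset V → ℝ) →ₗ[ℝ] ℝ :=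
  ∑ S, ((∏ v ∈ S, p v) * ∏ v ∈ Sᶜ, (1 - p v)) • LinearMap.proj S

/-- The probability that the random set of `bernoulliExp` belongs to the family `𝒜`. -/
noncomputable def bernoulliProb (p : V → ℝ) (𝒜 : Set (Finset V)) : ℝ :=
  bernoulliExp p (𝒜.indicator 1)

lemma bernoulliExp_apply (f : Finset V → ℝ) :
    bernoulliExp p f = ∑ S, ((∏ v ∈ S, p v) * ∏ v ∈ Sᶜ, (1 - p v)) * f S := by
  simp [bernoulliExp]

lemma bernoulliExp_prod_mul_prod_compl (x y : V → ℝ) :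
    bernoulliExp p (fun S ↦ (∏ v ∈ S, x v) * ∏ v ∈ Sᶜ, y v) =
      ∏ v, (p v * x v + (1 - p v) * y v) := by
  simp only [bernoulliExp_apply, Fintype.prod_add, prod_mul_distrib]
  exact sum_congr rfl fun S _ ↦ by ring

lemma bernoulliExp_pow_card (a : ℝ) :
    bernoulliExp p (fun S ↦ a ^ #S) = ∏ v, (1 + (a - 1) * p v) := by
  have h := bernoulliExp_prod_mul_prod_compl (p := p) (fun _ ↦ a) fun _ ↦ 1
  simp only [prod_const, one_pow, mul_one] at h
  exact h.trans (prod_congr rfl fun v _ ↦ by ring)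

lemma bernoulliExp_one : bernoulliExp p 1 = 1 := by
  simpa [Pi.one_def] using bernoulliExp_pow_card (p := p) 1

lemma bernoulliProb_Icc {A C : Finset V} (hAC : A ⊆ C) :
    bernoulliProb p (Set.Icc A C) = (∏ v ∈ A, p v) * ∏ v ∈ Cᶜ, (1 - p v) := by
  have hindicator : (Set.Icc A C).indicator 1 = fun S : Finset V ↦
      (∏ v ∈ S, if v ∈ C then (1 : ℝ) else 0) * ∏ v ∈ Sᶜ, if v ∉ A then (1 : ℝ) else 0 := by
    funext S
    have hA : (∀ v ∈ Sᶜ, v ∉ A) ↔ A ⊆ S := by simp [subset_iff, not_imp_not]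
    have hC : (∀ v ∈ S, v ∈ C) ↔ S ⊆ C := subset_iff.symm
    simp only [prod_ite_zero, hA, hC, prod_const_one, Set.indicator_apply, Set.mem_Icc,
      ite_and, mul_ite, mul_one, mul_zero, Pi.one_apply]
  have hfactor (v : V) : p v * (if v ∈ C then (1 : ℝ) else 0) + (1 - p v) * (if v ∉ A then 1 else 0)
      = (if v ∈ A then p v else 1) * if v ∈ Cᶜ then 1 - p v else 1 := by
    have := @hAC v
    by_cases hA : v ∈ A <;> by_cases hC : v ∈ C <;> simp_all
  rw [bernoulliProb, hindicator, bernoulliExp_prod_mul_prod_compl]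
  simp only [hfactor, prod_mul_distrib, prod_ite_mem, univ_inter]

lemma bernoulliProb_Ici (A : Finset V) : bernoulliProb p (Set.Ici A) = ∏ v ∈ A, p v := by
  rw [← Set.Icc_top, top_eq_univ, bernoulliProb_Icc (subset_univ A)]
  simp

lemma bernoulliProb_Iic (C : Finset V) :
    bernoulliProb p (Set.Iic C) = ∏ v ∈ Cᶜ, (1 - p v) := by
  rw [← Set.Icc_bot, bot_eq_empty, bernoulliProb_Icc (empty_subset C)]
  simp

lemma bernoulliExp_card : bernoulliExp p (fun S ↦ (#S : ℝ)) = ∑ v, p v := by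
  have hsum : (fun S : Finset V ↦ (#S : ℝ)) = ∑ v, (Set.Ici {v}).indicator 1 := by
    funext S
    simp [Finset.sum_apply, Set.indicator_apply]
  rw [hsum, map_sum]
  exact sum_congr rfl fun v _ ↦ (bernoulliProb_Ici {v}).trans (prod_singleton p v)

lemma bernoulliExp_mono (hp : ∀ v, p v ∈ Set.Icc 0 1) : Monotone (bernoulliExp p) := by
  intro f g hfg
  simp only [bernoulliExp_apply]
  refine sum_le_sum fun S _ ↦ mul_le_mul_of_nonneg_left (hfg S) ?_
  exact mul_nonneg (prod_nonneg fun v _ ↦ (hp v).1)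
    (prod_nonneg fun v _ ↦ sub_nonneg.mpr (hp v).2)

lemma exists_le_bernoulliExp (hp : ∀ v, p v ∈ Set.Icc 0 1) (f : Finset V → ℝ) :
    ∃ S, f S ≤ bernoulliExp p f := by
  obtain ⟨S, hS⟩ := Finite.exists_min f
  refine ⟨S, ?_⟩
  calc f S = bernoulliExp p (f S • 1) := by rw [map_smul, bernoulliExp_one, smul_eq_mul, mul_one]
    _ ≤ bernoulliExp p f := bernoulliExp_mono hp fun T ↦ by simpa using hS T

lemma exists_notMem_pos_of_mul_bernoulliProb_lt (hp : ∀ v, p v ∈ Set.Icc 0 1)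
    {f : Finset V → ℝ} {b : ℝ} (hf : ∀ S, f S ≤ b) {𝒜 : Set (Finset V)}
    (h𝒜 : b * bernoulliProb p 𝒜 < bernoulliExp p f) : ∃ S ∉ 𝒜, 0 < f S := by
  contrapose! h𝒜
  calc bernoulliExp p f ≤ bernoulliExp p (b • 𝒜.indicator 1) := by
        refine bernoulliExp_mono hp fun S ↦ ?_
        by_cases hS : S ∈ 𝒜
        · simpa [hS] using hf S
        · simpa [hS] using h𝒜 S hS
    _ = b * bernoulliProb p 𝒜 := map_smul _ _ _

lemma bernoulliProb_le_card_le_exp (hp : ∀ v, p v ∈ Set.Icc 0 1) {t : ℝ} (ht : 0 ≤ t) (x : ℝ) :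
    bernoulliProb p {S | x ≤ #S} ≤ Real.exp ((Real.exp t - 1) * ∑ v, p v - t * x) := by
  calc bernoulliProb p {S | x ≤ #S}
      ≤ bernoulliExp p (Real.exp (-(t * x)) • fun S ↦ Real.exp t ^ #S) := by
        refine bernoulliExp_mono hp (Set.indicator_le' ?_ ?_)
        · intro S hS
          simp only [Pi.one_apply, Pi.smul_apply, smul_eq_mul, ← Real.exp_nat_mul, ← Real.exp_add]
          have : t * x ≤ t * #S := mul_le_mul_of_nonneg_left hS ht
          exact Real.one_le_exp (by linarith)
        · intro S _
          simp only [Pi.smul_apply, smul_eq_mul]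
          positivity
    _ = Real.exp (-(t * x)) * ∏ v, (1 + (Real.exp t - 1) * p v) := by
        rw [map_smul, bernoulliExp_pow_card, smul_eq_mul]
    _ ≤ Real.exp (-(t * x)) * ∏ v, Real.exp ((Real.exp t - 1) * p v) := by
        refine mul_le_mul_of_nonneg_left (prod_le_prod (fun v _ ↦ ?_) fun v _ ↦ ?_) (by positivity)
        · have := mul_nonneg (sub_nonneg.mpr (Real.one_le_exp ht)) (hp v).1
          positivity
        · rw [add_comm]
          exact Real.add_one_le_exp _
    _ = _ := by
        rw [← Real.exp_sum, ← mul_sum, ← Real.exp_add]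
        ring_nf

lemma bernoulliExp_div_le_bernoulliProb_ne_zero (hp : ∀ v, p v ∈ Set.Icc 0 1)
    {f : Finset V → ℝ} {b : ℝ} (hb : 0 < b) (hf : bernoulliExp p (f ^ 2) ≤ b * bernoulliExp p f) :
    bernoulliExp p f / b ≤ bernoulliProb p {S | f S ≠ 0} := by
  -- Take expectations in `2 * (f / b) - (f / b) ^ 2 ≤ 1`, which holds wherever `f ≠ 0`.
  calc bernoulliExp p f / b = 2 * b⁻¹ * bernoulliExp p f - b⁻¹ ^ 2 * (b * bernoulliExp p f) := by
        field_simp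
        ring
    _ ≤ 2 * b⁻¹ * bernoulliExp p f - b⁻¹ ^ 2 * bernoulliExp p (f ^ 2) := by gcongr
    _ = bernoulliExp p ((2 * b⁻¹) • f - b⁻¹ ^ 2 • f ^ 2) := by simp
    _ ≤ bernoulliProb p {S | f S ≠ 0} := by
        refine bernoulliExp_mono hp fun S ↦ ?_
        by_cases hS : f S = 0
        · simp [hS]
        · suffices 2 * b⁻¹ * f S - b⁻¹ ^ 2 * f S ^ 2 ≤ 1 by simpa [hS] using this
          linarith [sq_nonneg (b⁻¹ * f S - 1)]

end BernoulliSubset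

section Graph

variable {V : Type*} {H : SimpleGraph V}

lemma not_isIndepSet_iff {S : Set V} :
    ¬ H.IsIndepSet S ↔ ∃ u ∈ S, ∃ v ∈ S, H.Adj u v := by
  rw [SimpleGraph.isIndepSet_iff, Set.Pairwise]
  push Not
  constructor
  · rintro ⟨u, hu, v, hv, -, huv⟩
    exact ⟨u, hu, v, hv, huv⟩
  · rintro ⟨u, hu, v, hv, huv⟩
    exact ⟨u, hu, v, hv, huv.ne, huv⟩

lemma prod_toFinset_sdiff_le [DecidableEq V] {p : V → ℝ} {q : ℝ}
    (hp : ∀ v, p v ∈ Set.Icc 0 q) {e f : Sym2 V}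
    (he : ¬ e.IsDiag) (hf : ¬ f.IsDiag) :
    ∏ v ∈ f.toFinset \ e.toFinset, p v ≤
      (if f = e then 1 else 0) + q * #(e.toFinset ∩ f.toFinset) + q ^ 2 := by
  have hq₀ : 0 ≤ q := (hp f.out.1).1.trans (hp f.out.1).2
  have hcard := card_sdiff_add_card_inter f.toFinset e.toFinset
  rw [f.card_toFinset_of_not_isDiag hf, inter_comm] at hcard
  refine (prod_le_prod (fun v _ ↦ (hp v).1) fun v _ ↦ (hp v).2).trans ?_
  rw [prod_const]
  obtain h | h | h : #(f.toFinset \ e.toFinset) = 0 ∨ #(f.toFinset \ e.toFinset) = 1 ∨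
    #(f.toFinset \ e.toFinset) = 2 := by omega
  · have hfe : f.toFinset = e.toFinset :=
      eq_of_subset_of_card_le (sdiff_eq_empty_iff_subset.mp (card_eq_zero.mp h))
        (by rw [e.card_toFinset_of_not_isDiag he, f.card_toFinset_of_not_isDiag hf])
    rw [h, if_pos (Sym2.ext fun v ↦ by rw [← Sym2.mem_toFinset, hfe, Sym2.mem_toFinset])]
    nlinarith [sq_nonneg q]
  · rw [h, show #(e.toFinset ∩ f.toFinset) = 1 by omega, Nat.cast_one]
    split_ifs <;> nlinarith [sq_nonneg q]
  · rw [h, show #(e.toFinset ∩ f.toFinset) = 0 by omega, Nat.cast_zero]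
    split_ifs <;> nlinarith [sq_nonneg q]

variable [Fintype V] [DecidableEq V] [DecidableRel H.Adj] {p : V → ℝ}

lemma mul_one_sub_prod_neighborFinset_le (hp : ∀ v, p v ∈ Set.Icc 0 1) (v : V) :
    p v * (1 - ∏ u ∈ H.neighborFinset v, (1 - p u)) ≤
      bernoulliProb p {S | ¬ H.IsIndepSet (S : Set V)} := by
  have hv : {v} ⊆ (H.neighborFinset v)ᶜ := by simp
  calc p v * (1 - ∏ u ∈ H.neighborFinset v, (1 - p u))
      = bernoulliProb p (Set.Ici {v}) - bernoulliProb p (Set.Icc {v} (H.neighborFinset v)ᶜ) := by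
        rw [bernoulliProb_Ici, bernoulliProb_Icc hv, prod_singleton, compl_compl]
        ring
    _ = bernoulliExp p ((Set.Ici {v}).indicator 1 -
          (Set.Icc {v} (H.neighborFinset v)ᶜ).indicator 1) := (map_sub _ _ _).symm
    _ = bernoulliProb p (Set.Ici {v} \ Set.Icc {v} (H.neighborFinset v)ᶜ) := by
        rw [bernoulliProb, Set.indicator_sdiff' Set.Icc_subset_Ici_self, sub_eq_add_neg]
    _ ≤ bernoulliProb p {S | ¬ H.IsIndepSet (S : Set V)} := by
        refine bernoulliExp_mono hp (Set.indicator_le_indicator_of_subset ?_ fun _ ↦ zero_le_one)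
        rintro S ⟨hvS, hS⟩
        have hvS' : v ∈ S := singleton_subset_iff.mp hvS
        obtain ⟨u, huS, hu⟩ := not_subset.mp fun h ↦ hS ⟨hvS, h⟩
        exact not_isIndepSet_iff.mpr ⟨v, hvS', u, huS, by simpa using hu⟩

/-- The number of edges of `H` with both ends in `S`, as a sum of indicator functions of `S`. -/
noncomputable def edgeCount (H : SimpleGraph V) [DecidableRel H.Adj] : Finset V → ℝ :=
  ∑ e ∈ H.edgeFinset, (Set.Ici e.toFinset).indicator 1

lemma setOf_edgeCount_ne_zero :
    {S | edgeCount H S ≠ 0} = {S : Finset V | ¬ H.IsIndepSet (S : Set V)} := by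
  ext S
  have hnonneg : ∀ e ∈ H.edgeFinset, 0 ≤ (Set.Ici e.toFinset).indicator (1 : Finset V → ℝ) S :=
    fun e _ ↦ Set.indicator_nonneg (fun _ _ ↦ zero_le_one) S
  rw [Set.mem_ofPred_eq, Set.mem_ofPred_eq, not_isIndepSet_iff, edgeCount, Finset.sum_apply, ne_eq,
    sum_eq_zero_iff_of_nonneg hnonneg]
  push Not
  constructor
  · rintro ⟨e, he, heS⟩
    induction e with | _ u v
    have huv : {u, v} ⊆ S := Sym2.toFinset_mk_eq (x := u) ▸ Set.mem_of_indicator_ne_zero heS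
    rw [insert_subset_iff, singleton_subset_iff] at huv
    exact ⟨u, huv.1, v, huv.2, by simpa using he⟩
  · rintro ⟨u, hu, v, hv, huv⟩
    refine ⟨s(u, v), by simpa using huv, ?_⟩
    have huvS : {u, v} ⊆ S := insert_subset hu (singleton_subset_iff.mpr hv)
    simp [Sym2.toFinset_mk_eq, huvS]

lemma bernoulliExp_edgeCount :
    bernoulliExp p (edgeCount H) = ∑ e ∈ H.edgeFinset, ∏ v ∈ e.toFinset, p v := by
  rw [edgeCount, map_sum]
  exact sum_congr rfl fun e _ ↦ bernoulliProb_Ici _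

lemma bernoulliExp_edgeCount_sq :
    bernoulliExp p (edgeCount H ^ 2) =
      ∑ e ∈ H.edgeFinset, ∑ f ∈ H.edgeFinset, ∏ v ∈ e.toFinset ∪ f.toFinset, p v := by
  rw [edgeCount, sq, sum_mul_sum, map_sum]
  refine sum_congr rfl fun e _ ↦ ?_
  rw [map_sum]
  refine sum_congr rfl fun f _ ↦ ?_
  rw [← Set.inter_indicator_one, Set.Ici_inter_Ici, sup_eq_union]
  exact bernoulliProb_Ici _

lemma sum_card_toFinset_inter_toFinset {e : Sym2 V} :
    ∑ f ∈ H.edgeFinset, #(e.toFinset ∩ f.toFinset) = ∑ v ∈ e.toFinset, H.degree v := by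
  calc ∑ f ∈ H.edgeFinset, #(e.toFinset ∩ f.toFinset)
      = ∑ v ∈ e.toFinset, #{f ∈ H.edgeFinset | v ∈ f} := by
        simp only [← filter_mem_eq_inter, Sym2.mem_toFinset]
        exact sum_card_bipartiteAbove_eq_sum_card_bipartiteBelow fun f v ↦ v ∈ f
    _ = ∑ v ∈ e.toFinset, H.degree v := sum_congr rfl fun v _ ↦ by
        rw [← SimpleGraph.incidenceFinset_eq_filter, SimpleGraph.card_incidenceFinset_eq_degree]

lemma sum_prod_toFinset_sdiff_le {q t : ℝ} (hp : ∀ v, p v ∈ Set.Icc 0 q)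
    (ht : ∀ v, H.degree v ≤ t) {e : Sym2 V} (he : e ∈ H.edgeFinset) :
    ∑ f ∈ H.edgeFinset, ∏ v ∈ f.toFinset \ e.toFinset, p v ≤
      1 + 2 * t * q + #H.edgeFinset * q ^ 2 := by
  have hdiag {f : Sym2 V} (hf : f ∈ H.edgeFinset) : ¬ f.IsDiag :=
    H.not_isDiag_of_mem_edgeFinset hf
  have hq₀ : 0 ≤ q := (hp e.out.1).1.trans (hp e.out.1).2
  have hdegree : ∑ v ∈ e.toFinset, (H.degree v : ℝ) ≤ 2 * t := by
    simpa [e.card_toFinset_of_not_isDiag (hdiag he)] using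
      sum_le_card_nsmul e.toFinset (fun v ↦ (H.degree v : ℝ)) t fun v _ ↦ ht v
  calc ∑ f ∈ H.edgeFinset, ∏ v ∈ f.toFinset \ e.toFinset, p v
      ≤ ∑ f ∈ H.edgeFinset,
          ((if f = e then 1 else 0) + q * #(e.toFinset ∩ f.toFinset) + q ^ 2) :=
        sum_le_sum fun f hf ↦ prod_toFinset_sdiff_le hp (hdiag he) (hdiag hf)
    _ = 1 + q * ∑ v ∈ e.toFinset, (H.degree v : ℝ) + #H.edgeFinset * q ^ 2 := by
        rw [sum_add_distrib, sum_add_distrib, sum_ite_eq', if_pos he, ← mul_sum, sum_const,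
          nsmul_eq_mul, ← Nat.cast_sum, sum_card_toFinset_inter_toFinset, Nat.cast_sum]
    _ ≤ 1 + q * (2 * t) + #H.edgeFinset * q ^ 2 := by gcongr
    _ = 1 + 2 * t * q + #H.edgeFinset * q ^ 2 := by ring

lemma bernoulliExp_edgeCount_sq_le {q t : ℝ} (hp : ∀ v, p v ∈ Set.Icc 0 q)
    (ht : ∀ v, H.degree v ≤ t) :
    bernoulliExp p (edgeCount H ^ 2) ≤
      (1 + 2 * t * q + #H.edgeFinset * q ^ 2) * bernoulliExp p (edgeCount H) := by
  rw [bernoulliExp_edgeCount_sq, bernoulliExp_edgeCount, mul_sum]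
  refine sum_le_sum fun e he ↦ ?_
  calc ∑ f ∈ H.edgeFinset, ∏ v ∈ e.toFinset ∪ f.toFinset, p v
      = (∑ f ∈ H.edgeFinset, ∏ v ∈ f.toFinset \ e.toFinset, p v) * ∏ v ∈ e.toFinset, p v := by
        rw [sum_mul]
        refine sum_congr rfl fun f _ ↦ ?_
        rw [← union_sdiff_self_eq_union, prod_union disjoint_sdiff, mul_comm]
    _ ≤ (1 + 2 * t * q + #H.edgeFinset * q ^ 2) * ∏ v ∈ e.toFinset, p v :=
        mul_le_mul_of_nonneg_right (sum_prod_toFinset_sdiff_le hp ht he)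
          (prod_nonneg fun v _ ↦ (hp v).1)

lemma div_le_bernoulliProb_not_isIndepSet [Nonempty V] {q r t : ℝ} (hr : 0 ≤ r)
    (hp : ∀ v, p v ∈ Set.Icc r q) (hq : q ≤ 1) (ht : ∀ v, H.degree v ≤ t) :
    #H.edgeFinset * r ^ 2 / (1 + 2 * t * q + #H.edgeFinset * q ^ 2) ≤
      bernoulliProb p {S | ¬ H.IsIndepSet (S : Set V)} := by
  have hp₀ (v : V) : p v ∈ Set.Icc 0 q := ⟨hr.trans (hp v).1, (hp v).2⟩
  have hexp : #H.edgeFinset * r ^ 2 ≤ bernoulliExp p (edgeCount H) := by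
    rw [bernoulliExp_edgeCount, ← nsmul_eq_mul]
    refine card_nsmul_le_sum _ _ _ fun e he ↦ ?_
    rw [← e.card_toFinset_of_not_isDiag (H.not_isDiag_of_mem_edgeFinset he), ← prod_const]
    exact prod_le_prod (fun _ _ ↦ hr) fun v _ ↦ (hp v).1
  have hb : 0 < 1 + 2 * t * q + #H.edgeFinset * q ^ 2 := by
    obtain ⟨v⟩ := ‹Nonempty V›
    have hq₀ : 0 ≤ q := (hp₀ v).1.trans (hp₀ v).2
    have ht₀ : 0 ≤ t := (Nat.cast_nonneg _).trans (ht v)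
    positivity
  calc #H.edgeFinset * r ^ 2 / (1 + 2 * t * q + #H.edgeFinset * q ^ 2)
      ≤ bernoulliExp p (edgeCount H) / (1 + 2 * t * q + #H.edgeFinset * q ^ 2) := by gcongr
    _ ≤ bernoulliProb p {S | edgeCount H S ≠ 0} :=
        bernoulliExp_div_le_bernoulliProb_ne_zero
          (fun v ↦ ⟨(hp₀ v).1, (hp₀ v).2.trans hq⟩) hb (bernoulliExp_edgeCount_sq_le hp₀ ht)
    _ = bernoulliProb p {S | ¬ H.IsIndepSet (S : Set V)} := by rw [setOf_edgeCount_ne_zero]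

end Graph

section ExpBounds

lemma one_le_logb_two {k : ℝ} (hk : 2 ≤ k) : 1 ≤ Real.logb 2 k := by
  rwa [Real.le_logb_iff_rpow_le one_lt_two (by linarith), Real.rpow_one]

lemma exp_neg_le_inv_two_pow_mul_pow {k x : ℝ} (hk : 1 ≤ k) (a b : ℕ)
    (hx : a + b * Real.logb 2 k ≤ x) : Real.exp (-x) ≤ (2 ^ a * k ^ b)⁻¹ := by
  have hlog_two : Real.log 2 ≤ 1 := by linarith [Real.log_two_lt_d9]
  have hlog : Real.log k ≤ Real.logb 2 k :=
    le_div_self (Real.log_nonneg hk) (Real.log_pos one_lt_two) hlog_two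
  have hexp : 2 ^ a * k ^ b = Real.exp (a * Real.log 2 + b * Real.log k) := by
    rw [Real.exp_add, Real.exp_nat_mul, Real.exp_nat_mul, Real.exp_log two_pos,
      Real.exp_log (by linarith)]
  rw [hexp, ← Real.exp_neg, Real.exp_le_exp, neg_le_neg_iff]
  refine le_trans (add_le_add ?_ ?_) hx
  · exact mul_le_of_le_one_right a.cast_nonneg hlog_two
  · exact mul_le_mul_of_nonneg_left hlog b.cast_nonneg

lemma prod_one_sub_le_exp_neg {V : Type*} {A : Finset V} {p : V → ℝ} {x : ℝ}
    (hp : ∀ v ∈ A, p v ∈ Set.Icc x 1) : ∏ v ∈ A, (1 - p v) ≤ Real.exp (-(x * #A)) := by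
  calc ∏ v ∈ A, (1 - p v) ≤ ∏ _v ∈ A, Real.exp (-x) :=
        prod_le_prod (fun v hv ↦ sub_nonneg.mpr (hp v hv).2) fun v hv ↦
          (sub_le_sub_left (hp v hv).1 1).trans (Real.one_sub_le_exp_neg x)
    _ = Real.exp (-(x * #A)) := by
        rw [prod_const, ← Real.exp_nat_mul]
        ring_nf

lemma one_sub_inv_pow_le {k : ℝ} (hk : 2 ≤ k) {m : ℕ} (hm : 60 * k * Real.logb 2 k ≤ m) :
    (1 - (4 * k)⁻¹) ^ m ≤ (4 * k)⁻¹ := by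
  have : 0 < k := by linarith
  have hL := one_le_logb_two hk
  have hm' : 15 * Real.logb 2 k ≤ (4 * k)⁻¹ * m := by
    calc 15 * Real.logb 2 k = (4 * k)⁻¹ * (60 * k * Real.logb 2 k) := by
          field_simp
          norm_num
      _ ≤ (4 * k)⁻¹ * m := by gcongr
  calc (1 - (4 * k)⁻¹) ^ m ≤ Real.exp (-(4 * k)⁻¹) ^ m := by
        have : (4 * k)⁻¹ ≤ 1 := inv_le_one_of_one_le₀ (by linarith)
        gcongr
        exact Real.one_sub_le_exp_neg _
    _ = Real.exp (-((4 * k)⁻¹ * m)) := by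
        rw [← Real.exp_nat_mul]
        ring_nf
    _ ≤ (2 ^ 2 * k ^ 1)⁻¹ :=
        exp_neg_le_inv_two_pow_mul_pow (by linarith) 2 1 (by push_cast; linarith)
    _ = (4 * k)⁻¹ := by norm_num

end ExpBounds

section Transversal

variable {V ι : Type*} [Fintype V] [Fintype ι]

lemma exists_transversal_card_le {A : ι → Finset V} (hA : ∀ i, (A i).Nonempty) {q : ℝ}
    (hq : q ∈ Set.Icc 0 1) :
    ∃ T : Finset V, (∀ i, ∃ v ∈ A i, v ∈ T) ∧
      (#T : ℝ) ≤ Fintype.card V * q + ∑ i, (1 - q) ^ #(A i) := by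
  -- Alteration: add to a random set a representative of every `A i` it misses.
  classical
  choose rep hrep using hA
  let missed (S : Finset V) : Finset ι := {i | S ⊆ (A i)ᶜ}
  have hmissed : (fun S ↦ (#(missed S) : ℝ)) = ∑ i, (Set.Iic (A i)ᶜ).indicator 1 := by
    funext S
    simp [missed, Finset.sum_apply, Set.indicator_apply]
  have hexp : bernoulliExp (fun _ ↦ q) (fun S ↦ (#S + #(missed S) : ℝ)) =
      Fintype.card V * q + ∑ i, (1 - q) ^ #(A i) := by
    change bernoulliExp _ ((fun S ↦ (#S : ℝ)) + fun S ↦ (#(missed S) : ℝ)) = _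
    rw [map_add, bernoulliExp_card, hmissed, map_sum, sum_const, nsmul_eq_mul, card_univ]
    congr 1
    refine sum_congr rfl fun i _ ↦ ?_
    rw [← bernoulliProb, bernoulliProb_Iic, compl_compl, prod_const]
  obtain ⟨S, hS⟩ := exists_le_bernoulliExp (fun _ ↦ hq) fun S ↦ (#S + #(missed S) : ℝ)
  refine ⟨S ∪ (missed S).image rep, fun i ↦ ?_, ?_⟩
  · by_cases hSi : S ⊆ (A i)ᶜ
    · exact ⟨rep i, hrep i, mem_union_right _ (mem_image_of_mem _ (by simp [missed, hSi]))⟩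
    · obtain ⟨v, hvS, hv⟩ := not_subset.mp hSi
      exact ⟨v, by simpa using hv, mem_union_left _ hvS⟩
  · rw [← hexp]
    refine le_trans ?_ hS
    exact_mod_cast (card_union_le _ _).trans (Nat.add_le_add_left card_image_le _)

lemma exists_transversal_card_le_div {k : ℝ} (hk : 2 ≤ k)
    (hcard : Fintype.card ι ≤ Fintype.card V) {A : ι → Finset V}
    (hA : ∀ i, 60 * k * Real.logb 2 k ≤ #(A i)) :
    ∃ T : Finset V, (∀ i, ∃ v ∈ A i, v ∈ T) ∧ (#T : ℝ) ≤ Fintype.card V / (2 * k) := by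
  have hL := one_le_logb_two hk
  have : 0 < k := by linarith
  let q := (4 * k)⁻¹
  have hq : q ∈ Set.Icc 0 1 := ⟨by positivity, inv_le_one_of_one_le₀ (by linarith)⟩
  have hA_nonempty (i : ι) : (A i).Nonempty := by
    rw [← card_pos, ← Nat.cast_pos (α := ℝ)]
    exact lt_of_lt_of_le (by positivity) (hA i)
  obtain ⟨T, hTA, hT⟩ := exists_transversal_card_le hA_nonempty hq
  refine ⟨T, hTA, hT.trans ?_⟩
  calc Fintype.card V * q + ∑ i, (1 - q) ^ #(A i)
      ≤ Fintype.card V * q + Fintype.card ι * q := by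
        rw [← nsmul_eq_mul (Fintype.card ι), ← card_univ (α := ι)]
        gcongr
        exact sum_le_card_nsmul _ _ _ fun i _ ↦ one_sub_inv_pow_le hk (hA i)
    _ ≤ Fintype.card V * q + Fintype.card V * q := by
        have := hq.1
        gcongr
    _ = Fintype.card V / (2 * k) := by
        simp only [q]
        field_simp
        ring

end Transversal

lemma exists_injOn_and_forall_exists_mem {V ι : Type*} [Finite V] [Nonempty V] [Nonempty ι]
    (R : V → ι → Prop) :
    ∃ (W : Finset V) (g : V → ι), Set.InjOn g W ∧ (∀ v ∈ W, R v (g v)) ∧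
      ∀ i, (∃ v, R v i) → ∃ v ∈ W, R v i := by
  let D : Set ι := {i | ∃ v, R v i}
  have hD : ∀ i ∈ D, ∃ v, R v i := fun i hi ↦ hi
  choose! r hr using hD
  refine ⟨(Set.toFinite (r '' D)).toFinset, Function.invFunOn r D, ?_, fun v hv ↦ ?_,
    fun i hi ↦ ⟨r i, ?_, hr i hi⟩⟩
  · rw [Set.Finite.coe_toFinset]
    exact Function.invFunOn_injOn_image r D
  · rw [Set.Finite.mem_toFinset] at hv
    have h := hr _ (Function.invFunOn_mem hv)
    rwa [Function.invFunOn_eq hv] at h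
  · rw [Set.Finite.mem_toFinset]
    exact Set.mem_image_of_mem r hi

lemma card_le_card_union_image_inter {V ι : Type*} [Fintype V] [DecidableEq V] [DecidableEq ι]
    {W : Finset V} {g : V → ι} (hg : Set.InjOn g W) {I : Finset ι} (hI : Disjoint I (W.image g))
    (hIW : #I = #Wᶜ) (S : Finset V) : #S ≤ #(I ∪ (S ∩ W).image g) := by
  calc #S = #(S ∩ W) + #(S \ W) := (card_inter_add_card_sdiff S W).symm
    _ ≤ #(S ∩ W) + #Wᶜ := by
      gcongr
      exact sdiff_subset_sdiff (subset_univ S) le_rfl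
    _ = #I + #((S ∩ W).image g) := by
      rw [card_image_of_injOn (hg.mono (by simp)), hIW, add_comm]
    _ = #(I ∪ (S ∩ W).image g) :=
      (card_union_of_disjoint (hI.mono_right (image_subset_image inter_subset_right))).symm

section SpannedIndices

variable {V ι : Type*} [Fintype ι] {H : ι → SimpleGraph V}

open Classical in
/-- The indices `i` such that `H i` has an edge with both ends in `S`. -/
noncomputable def spannedIndices (H : ι → SimpleGraph V) (S : Finset V) : Finset ι :=
  {i | ¬ (H i).IsIndepSet (S : Set V)}

lemma mem_spannedIndices {S : Finset V} {i : ι} :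
    i ∈ spannedIndices H S ↔ ∃ u ∈ S, ∃ v ∈ S, (H i).Adj u v := by
  classical
  rw [spannedIndices, mem_filter_univ, not_isIndepSet_iff]
  simp only [mem_coe]

variable [Fintype V] [DecidableEq V]

lemma bernoulliExp_card_spannedIndices (p : V → ℝ) :
    bernoulliExp p (fun S ↦ (#(spannedIndices H S) : ℝ)) =
      ∑ i, bernoulliProb p {S | ¬ (H i).IsIndepSet (S : Set V)} := by
  classical
  have hsum : (fun S ↦ (#(spannedIndices H S) : ℝ)) =
      ∑ i, {S : Finset V | ¬ (H i).IsIndepSet (S : Set V)}.indicator 1 := by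
    funext S
    simp [spannedIndices, Finset.sum_apply, Set.indicator_apply, card_filter]
  rw [hsum, map_sum]
  rfl

lemma exists_card_le_card_spannedIndices_of_transversal [Nonempty V]
    (hcard : Fintype.card V ≤ Fintype.card ι) (hH : ∀ i, H i ≠ ⊥) {W T : Finset V} {g : V → ι}
    (hg : Set.InjOn g W) (hT : ∀ v ∈ W, ∃ u ∈ T, (H (g v)).Adj v u) :
    ∃ S : Finset V, S.Nonempty ∧ #S ≤ 3 * #Wᶜ + #T ∧ #S ≤ #(spannedIndices H S) := by
  classical
  have hedge (i : ι) : ∃ u v, (H i).Adj u v := SimpleGraph.ne_bot_iff_exists_adj.mp (hH i)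
  choose x y hxy using hedge
  obtain ⟨I, hIg, hI⟩ : ∃ I ⊆ (W.image g)ᶜ, #I = #Wᶜ := by
    refine exists_subset_card_eq ?_
    rw [card_compl, card_compl, card_image_of_injOn hg]
    omega
  let S := Wᶜ ∪ T ∪ (I.image x ∪ I.image y)
  have hWS : Wᶜ ⊆ S := subset_union_left.trans subset_union_left
  have hTS : T ⊆ S := subset_union_right.trans subset_union_left
  have hspanned : I ∪ (S ∩ W).image g ⊆ spannedIndices H S := by
    refine union_subset (fun i hi ↦ ?_) (image_subset_iff.mpr fun v hv ↦ ?_)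
    · exact mem_spannedIndices.mpr
        ⟨x i, mem_union_right _ (mem_union_left _ (mem_image_of_mem x hi)),
          y i, mem_union_right _ (mem_union_right _ (mem_image_of_mem y hi)), hxy i⟩
    · obtain ⟨hvS, hvW⟩ := mem_inter.mp hv
      obtain ⟨u, hu, huv⟩ := hT v hvW
      exact mem_spannedIndices.mpr ⟨v, hvS, u, hTS hu, huv⟩
  refine ⟨S, ?_, ?_, ?_⟩
  · obtain ⟨v⟩ := ‹Nonempty V›
    by_cases hv : v ∈ W
    · obtain ⟨u, hu, -⟩ := hT v hv
      exact ⟨u, hTS hu⟩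
    · exact ⟨v, hWS (mem_compl.mpr hv)⟩
  · have hends := (card_union_le (I.image x) (I.image y)).trans
      (Nat.add_le_add card_image_le card_image_le)
    have hS : #S ≤ _ := (card_union_le (Wᶜ ∪ T) (I.image x ∪ I.image y)).trans
      (Nat.add_le_add (card_union_le _ _) hends)
    omega
  · exact (card_le_card_union_image_inter hg (disjoint_compl_left.mono_left hIg) hI S).trans
      (card_le_card hspanned)

end SpannedIndices

section BiasedDensity

variable {V : Type*} [DecidableEq V] {W : Finset V} {k : ℝ}

/-- Vertex probabilities slightly below `1 / (4 k)` outside `W`, making `#Wᶜ` a gain in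
`∑ v, biasedDensity W k v` at almost no cost in the probability of spanning an edge. -/
noncomputable def biasedDensity (W : Finset V) (k : ℝ) (v : V) : ℝ :=
  if v ∈ W then (4 * k)⁻¹ else 3 / 4 * (4 * k)⁻¹

lemma biasedDensity_mem_Icc (hk : 2 ≤ k) (v : V) :
    biasedDensity W k v ∈ Set.Icc (3 / 4 * (4 * k)⁻¹) (4 * k)⁻¹ := by
  have hq : 0 ≤ (4 * k)⁻¹ := inv_nonneg.mpr (by linarith)
  rw [biasedDensity]
  split_ifs <;> constructor <;> linarith

lemma biasedDensity_mem_Icc_zero_one (hk : 2 ≤ k) (v : V) :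
    biasedDensity W k v ∈ Set.Icc 0 1 := by
  refine Set.Icc_subset_Icc ?_ ?_ (biasedDensity_mem_Icc hk v)
  · exact mul_nonneg (by norm_num) (inv_nonneg.mpr (by linarith))
  · exact inv_le_one_of_one_le₀ (by linarith)

variable [Fintype V]

lemma sum_biasedDensity :
    ∑ v, biasedDensity W k v = (Fintype.card V - #Wᶜ / 4) * (4 * k)⁻¹ := by
  have hW : (#W : ℝ) = Fintype.card V - #Wᶜ := by
    rw [← card_add_card_compl W]
    push_cast
    ring
  have hsum : ∑ v, biasedDensity W k v = #W * (4 * k)⁻¹ + #Wᶜ * (3 / 4 * (4 * k)⁻¹) := by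
    simp only [biasedDensity, sum_ite, sum_const, nsmul_eq_mul, filter_mem_eq_inter, univ_inter,
      filter_notMem_eq_sdiff, compl_eq_univ_sdiff]
  rw [hsum, hW]
  ring

variable {H : SimpleGraph V} [DecidableRel H.Adj]

lemma le_bernoulliProb_not_isIndepSet_of_mem (hk : 2 ≤ k) {v : V} (hv : v ∈ W)
    (hdegree : 60 * k * Real.logb 2 k ≤ H.degree v) :
    (4 * k)⁻¹ * (1 - (1024 * k)⁻¹) ≤
      bernoulliProb (biasedDensity W k) {S | ¬ H.IsIndepSet (S : Set V)} := by
  have hL := one_le_logb_two hk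
  have : 0 < (4 * k)⁻¹ := inv_pos.mpr (by linarith)
  have hexponent : 45 / 4 * Real.logb 2 k ≤ 3 / 4 * (4 * k)⁻¹ * H.degree v := by
    calc 45 / 4 * Real.logb 2 k = 3 / 4 * (4 * k)⁻¹ * (60 * k * Real.logb 2 k) := by
          field_simp
          norm_num
      _ ≤ 3 / 4 * (4 * k)⁻¹ * H.degree v := by gcongr
  have hmiss : ∏ u ∈ H.neighborFinset v, (1 - biasedDensity W k u) ≤ (1024 * k)⁻¹ := by
    calc ∏ u ∈ H.neighborFinset v, (1 - biasedDensity W k u)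
        ≤ Real.exp (-(3 / 4 * (4 * k)⁻¹ * H.degree v)) := by
          rw [← H.card_neighborFinset_eq_degree]
          exact prod_one_sub_le_exp_neg fun u _ ↦
            ⟨(biasedDensity_mem_Icc hk u).1, (biasedDensity_mem_Icc_zero_one hk u).2⟩
      _ ≤ (2 ^ 10 * k ^ 1)⁻¹ :=
          exp_neg_le_inv_two_pow_mul_pow (by linarith) 10 1 (by push_cast; linarith)
      _ = (1024 * k)⁻¹ := by norm_num
  calc (4 * k)⁻¹ * (1 - (1024 * k)⁻¹)
      ≤ biasedDensity W k v * (1 - ∏ u ∈ H.neighborFinset v, (1 - biasedDensity W k u)) := by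
        rw [biasedDensity, if_pos hv]
        gcongr
    _ ≤ _ := mul_one_sub_prod_neighborFinset_le (biasedDensity_mem_Icc_zero_one hk) v

lemma le_bernoulliProb_not_isIndepSet_of_degree_le [Nonempty V] (hk : 2 ≤ k)
    (hdegree : ∀ v, H.degree v ≤ 60 * k * Real.logb 2 k)
    (hedges : 301 * k * Real.logb 2 k ≤ #H.edgeFinset) :
    (4 * k)⁻¹ ≤ bernoulliProb (biasedDensity W k) {S | ¬ H.IsIndepSet (S : Set V)} := by
  have hL := one_le_logb_two hk
  have hq₀ : 0 < (4 * k)⁻¹ := inv_pos.mpr (by linarith)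
  have hq : (4 * k)⁻¹ ≤ 1 / 8 := by
    rw [one_div]
    exact inv_anti₀ (by norm_num) (by linarith)
  refine le_trans ?_ (div_le_bernoulliProb_not_isIndepSet (by positivity)
    (biasedDensity_mem_Icc hk) (by linarith) hdegree)
  have hdegree_mul : 2 * (60 * k * Real.logb 2 k) * (4 * k)⁻¹ = 30 * Real.logb 2 k := by
    field_simp
    norm_num
  have hedges_mul : 301 / 4 * Real.logb 2 k ≤ #H.edgeFinset * (4 * k)⁻¹ := by
    calc 301 / 4 * Real.logb 2 k = 301 * k * Real.logb 2 k * (4 * k)⁻¹ := by field_simp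
      _ ≤ #H.edgeFinset * (4 * k)⁻¹ := by gcongr
  rw [hdegree_mul, le_div_iff₀ (by positivity)]
  set q := (4 * k)⁻¹
  have hedges_sq : #H.edgeFinset * q ^ 2 ≤ #H.edgeFinset * q * (1 / 8) := by
    rw [sq, ← mul_assoc]
    gcongr
  calc q * (1 + 30 * Real.logb 2 k + #H.edgeFinset * q ^ 2)
      ≤ q * (9 / 16 * (#H.edgeFinset * q)) := by
        gcongr
        linarith
    _ = #H.edgeFinset * (3 / 4 * q) ^ 2 := by ring

lemma bernoulliProb_biasedDensity_le (hk : 2 ≤ k)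
    (hcard : 602 * k * Real.logb 2 k ≤ Fintype.card V) :
    bernoulliProb (biasedDensity W k) {S | Fintype.card V / k ≤ #S} ≤ (1024 * k ^ 2)⁻¹ := by
  have hL := one_le_logb_two hk
  have hk₀ : 0 < k := by linarith
  have hratio : 602 * Real.logb 2 k ≤ Fintype.card V / k := by
    rw [le_div_iff₀ hk₀]
    linarith
  have hsum : ∑ v, biasedDensity W k v ≤ Fintype.card V / k / 4 := by
    calc ∑ v, biasedDensity W k v ≤ ∑ _v : V, (4 * k)⁻¹ :=
          sum_le_sum fun v _ ↦ (biasedDensity_mem_Icc hk v).2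
      _ = Fintype.card V / k / 4 := by
          rw [sum_const, nsmul_eq_mul, card_univ]
          field_simp
  calc bernoulliProb (biasedDensity W k) {S | Fintype.card V / k ≤ #S}
      ≤ Real.exp ((Real.exp 1 - 1) * ∑ v, biasedDensity W k v - 1 * (Fintype.card V / k)) :=
        bernoulliProb_le_card_le_exp (biasedDensity_mem_Icc_zero_one hk) zero_le_one _
    _ ≤ Real.exp (-(Fintype.card V / k / 2)) := by
        rw [Real.exp_le_exp]
        nlinarith [Real.exp_one_lt_d9, Real.add_one_le_exp 1]
    _ ≤ (2 ^ 10 * k ^ 2)⁻¹ :=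
        exp_neg_le_inv_two_pow_mul_pow (by linarith) 10 2 (by push_cast; linarith)
    _ = (1024 * k ^ 2)⁻¹ := by norm_num

end BiasedDensity

section SpanningSet

variable {V ι : Type*} [Fintype V] [Nonempty V] [Fintype ι] {H : ι → SimpleGraph V} {k : ℝ}

lemma exists_card_le_card_spannedIndices_of_card_compl_le [DecidableEq V]
    [∀ i, DecidableRel (H i).Adj] (hk : 2 ≤ k)
    (hcard : Fintype.card V ≤ Fintype.card ι) (hH : ∀ i, H i ≠ ⊥) {W : Finset V} {g : V → ι}
    (hg : Set.InjOn g W) (hdegree : ∀ v ∈ W, 60 * k * Real.logb 2 k ≤ (H (g v)).degree v)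
    (hW : #Wᶜ ≤ Fintype.card V / (8 * k)) :
    ∃ S : Finset V, S.Nonempty ∧ #S ≤ Fintype.card V / k ∧ #S ≤ #(spannedIndices H S) := by
  obtain ⟨T, hTstar, hT⟩ := exists_transversal_card_le_div hk (ι := W)
    (by simpa using card_le_univ W) (A := fun v ↦ (H (g v)).neighborFinset v)
    fun v ↦ by simpa using hdegree v v.2
  have hTadj (v : V) (hv : v ∈ W) : ∃ u ∈ T, (H (g v)).Adj v u := by
    obtain ⟨u, hu, huT⟩ := hTstar ⟨v, hv⟩
    exact ⟨u, huT, by simpa using hu⟩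
  obtain ⟨S, hS, hSWT, hSspanned⟩ :=
    exists_card_le_card_spannedIndices_of_transversal hcard hH hg hTadj
  refine ⟨S, hS, ?_, hSspanned⟩
  calc (#S : ℝ) ≤ 3 * #Wᶜ + #T := by exact_mod_cast hSWT
    _ ≤ 3 * (Fintype.card V / (8 * k)) + Fintype.card V / (2 * k) := by gcongr
    _ = 7 / 8 * (Fintype.card V / k) := by
        field_simp
        norm_num
    _ ≤ Fintype.card V / k := mul_le_of_le_one_left (by positivity) (by norm_num)

lemma card_mul_bernoulliProb_lt_bernoulliExp [DecidableEq V] (hk : 2 ≤ k)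
    (hcard : Fintype.card V ≤ Fintype.card ι) (hV : 602 * k * Real.logb 2 k ≤ Fintype.card V)
    {W : Finset V} (hW : Fintype.card V / (8 * k) < #Wᶜ)
    (hspan : ∀ i, (4 * k)⁻¹ * (1 - (1024 * k)⁻¹) ≤
      bernoulliProb (biasedDensity W k) {S | ¬ (H i).IsIndepSet (S : Set V)}) :
    Fintype.card ι * bernoulliProb (biasedDensity W k) {S | Fintype.card V / k ≤ #S} <
      bernoulliExp (biasedDensity W k) (fun S ↦ (#(spannedIndices H S) - #S : ℝ)) := by
  have hexp : Fintype.card ι * ((4 * k)⁻¹ * (1 - (1024 * k)⁻¹)) -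
      (Fintype.card V - #Wᶜ / 4) * (4 * k)⁻¹ ≤
        bernoulliExp (biasedDensity W k) (fun S ↦ (#(spannedIndices H S) - #S : ℝ)) := by
    change _ ≤ bernoulliExp _ ((fun S ↦ (#(spannedIndices H S) : ℝ)) - fun S ↦ (#S : ℝ))
    rw [map_sub, bernoulliExp_card_spannedIndices, bernoulliExp_card, sum_biasedDensity,
      ← nsmul_eq_mul, ← card_univ (α := ι)]
    gcongr
    exact card_nsmul_le_sum _ _ _ fun i _ ↦ hspan i
  refine lt_of_lt_of_le ?_ hexp
  have hq : 0 < (4 * k)⁻¹ := inv_pos.mpr (by linarith)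
  have hq_le : (4 * k)⁻¹ ≤ 1 := inv_le_one_of_one_le₀ (by linarith)
  have htail : (1024 * k ^ 2)⁻¹ = (4 * k)⁻¹ ^ 2 / 64 := by field_simp; norm_num
  have hmiss : (1024 * k)⁻¹ = (4 * k)⁻¹ / 256 := by field_simp; norm_num
  have hgain : Fintype.card V / (8 * k) = Fintype.card V * (4 * k)⁻¹ / 2 := by
    field_simp; norm_num
  have hprob := bernoulliProb_biasedDensity_le (W := W) hk hV
  rw [htail] at hprob
  rw [hgain] at hW
  rw [hmiss]
  set q := (4 * k)⁻¹
  have hwaste : Fintype.card V - #Wᶜ / 4 < Fintype.card ι * (1 - 5 / 256 * q) := by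
    calc (Fintype.card V - #Wᶜ / 4 : ℝ) < Fintype.card V * (1 - 5 / 256 * q) := by nlinarith
      _ ≤ Fintype.card ι * (1 - 5 / 256 * q) := by
        gcongr
        linarith
  calc Fintype.card ι * bernoulliProb (biasedDensity W k) {S | Fintype.card V / k ≤ #S}
      ≤ Fintype.card ι * (q ^ 2 / 64) := by gcongr
    _ < Fintype.card ι * (q * (1 - q / 256)) - (Fintype.card V - #Wᶜ / 4) * q := by
      linarith [mul_lt_mul_of_pos_right hwaste hq]

lemma exists_card_le_card_spannedIndices_of_lt_card_compl [DecidableEq V] (hk : 2 ≤ k)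
    (hcard : Fintype.card V ≤ Fintype.card ι) (hV : 602 * k * Real.logb 2 k ≤ Fintype.card V)
    {W : Finset V} (hW : Fintype.card V / (8 * k) < #Wᶜ)
    (hspan : ∀ i, (4 * k)⁻¹ * (1 - (1024 * k)⁻¹) ≤
      bernoulliProb (biasedDensity W k) {S | ¬ (H i).IsIndepSet (S : Set V)}) :
    ∃ S : Finset V, S.Nonempty ∧ #S ≤ Fintype.card V / k ∧ #S ≤ #(spannedIndices H S) := by
  have hle (S : Finset V) : (#(spannedIndices H S) - #S : ℝ) ≤ Fintype.card ι :=
    (sub_le_self _ (Nat.cast_nonneg _)).trans (Nat.cast_le.mpr (card_le_univ _))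
  obtain ⟨S, hSV, hSpos⟩ := exists_notMem_pos_of_mul_bernoulliProb_lt
    (biasedDensity_mem_Icc_zero_one hk) hle
    (card_mul_bernoulliProb_lt_bernoulliExp hk hcard hV hW hspan)
  have hS : #S < #(spannedIndices H S) := by exact_mod_cast sub_pos.mp hSpos
  refine ⟨S, ?_, (not_le.mp hSV).le, hS.le⟩
  obtain ⟨i, hi⟩ := card_pos.mp (Nat.zero_lt_of_lt hS)
  obtain ⟨u, hu, -⟩ := mem_spannedIndices.mp hi
  exact ⟨u, hu⟩

lemma exists_card_le_card_spannedIndices [∀ i, DecidableRel (H i).Adj] (hk : 2 ≤ k)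
    (hcard : Fintype.card V ≤ Fintype.card ι) (hV : 602 * k * Real.logb 2 k ≤ Fintype.card V)
    (hedges : ∀ i, 301 * k * Real.logb 2 k ≤ #(H i).edgeFinset) :
    ∃ S : Finset V, S.Nonempty ∧ #S ≤ Fintype.card V / k ∧ #S ≤ #(spannedIndices H S) := by
  classical
  have hL := one_le_logb_two hk
  have : Nonempty ι := Fintype.card_pos_iff.mp (Fintype.card_pos.trans_le hcard)
  obtain ⟨W, g, hg, hcentre, hW⟩ := exists_injOn_and_forall_exists_mem
    fun (v : V) (i : ι) ↦ 60 * k * Real.logb 2 k ≤ (H i).degree v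
  obtain hfew | hmany := le_or_gt (#Wᶜ : ℝ) (Fintype.card V / (8 * k))
  · refine exists_card_le_card_spannedIndices_of_card_compl_le hk hcard (fun i hi ↦ ?_) hg hcentre
      hfew
    have hpos : (0 : ℝ) < #(H i).edgeFinset := lt_of_lt_of_le (by positivity) (hedges i)
    simp [hi] at hpos
  · refine exists_card_le_card_spannedIndices_of_lt_card_compl hk hcard hV hmany fun i ↦ ?_
    by_cases hi : ∃ v, 60 * k * Real.logb 2 k ≤ (H i).degree v
    · obtain ⟨v, hv, hiv⟩ := hW i hi
      exact le_bernoulliProb_not_isIndepSet_of_mem hk hv hiv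
    · push Not at hi
      refine le_trans ?_ (le_bernoulliProb_not_isIndepSet_of_degree_le hk (fun v ↦ (hi v).le)
        (hedges i))
      have hq : 0 ≤ (4 * k)⁻¹ := by positivity
      exact mul_le_of_le_one_right hq (sub_le_self _ (by positivity))

end SpanningSet

section ColorClass

variable {V α : Type*} {G : SimpleGraph V} {c : G.edgeSet → α}

/-- The spanning subgraph of `G` formed by the edges to which `c` gives the colour `i`. -/
def colorClass (c : G.edgeSet → α) (i : α) : SimpleGraph V :=
  .fromEdgeSet ((↑) '' (c ⁻¹' {i}))

lemma edgeSet_colorClass (i : α) : (colorClass c i).edgeSet = (↑) '' (c ⁻¹' {i}) := by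
  rw [colorClass, SimpleGraph.edgeSet_fromEdgeSet, sdiff_eq_left, Set.disjoint_left]
  rintro _ ⟨e, -, rfl⟩
  exact G.not_isDiag_of_mem_edgeSet e.2

lemma exists_eq_of_colorClass_adj {i : α} {u v : V} (huv : (colorClass c i).Adj u v) :
    ∃ e : G.edgeSet, c e = i ∧ (e : Sym2 V) = s(u, v) := by
  rwa [← SimpleGraph.mem_edgeSet, edgeSet_colorClass] at huv

lemma card_edgeFinset_colorClass (i : α) [Fintype (colorClass c i).edgeSet] :
    #(colorClass c i).edgeFinset = (c ⁻¹' {i}).ncard := by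
  rw [← Set.ncard_coe_finset, SimpleGraph.coe_edgeFinset, edgeSet_colorClass,
    Set.ncard_image_of_injective _ Subtype.val_injective]

lemma two_mul_le_card_of_forall_le_ncard_fiber [Fintype V] [Nonempty V] [Fintype α]
    (hα : Fintype.card V ≤ Fintype.card α) {x : ℝ} (hc : ∀ i, x ≤ (c ⁻¹' {i}).ncard) :
    2 * x ≤ Fintype.card V := by
  classical
  have hα₀ : (0 : ℝ) < Fintype.card α := Nat.cast_pos.mpr (Fintype.card_pos.trans_le hα)
  have hfibers : ∑ i, (c ⁻¹' {i}).ncard = #G.edgeFinset := by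
    rw [SimpleGraph.edgeFinset_card, ← card_univ,
      card_eq_sum_card_fiberwise (f := c) (t := univ) fun _ _ ↦ by simp]
    refine sum_congr rfl fun i _ ↦ ?_
    rw [← Set.ncard_coe_finset]
    congr 1
    ext
    simp
  have hedges : (2 * #G.edgeFinset : ℝ) ≤ Fintype.card V * Fintype.card V := by
    have hchoose : (#G.edgeFinset : ℝ) ≤ (Fintype.card V).choose 2 :=
      Nat.cast_le.mpr G.card_edgeFinset_le_card_choose_two
    rw [Nat.cast_choose_two] at hchoose
    linarith [(Fintype.card V).cast_nonneg (α := ℝ)]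
  refine le_of_mul_le_mul_left ?_ hα₀
  calc Fintype.card α * (2 * x) = 2 * (Fintype.card α * x) := by ring
    _ ≤ 2 * ∑ i, ((c ⁻¹' {i}).ncard : ℝ) := by
      rw [← nsmul_eq_mul (Fintype.card α)]
      gcongr
      exact card_nsmul_le_sum univ _ x fun i _ ↦ hc i
    _ = 2 * #G.edgeFinset := by rw [← hfibers, Nat.cast_sum]
    _ ≤ Fintype.card V * Fintype.card V := hedges
    _ ≤ Fintype.card α * Fintype.card V := by gcongr

end ColorClass

theorem theorem2p1_general {V α : Type*} [Fintype V] [Nonempty V] [Fintype α]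
    (hα : Fintype.card V ≤ Fintype.card α) (G : SimpleGraph V) {k : ℝ} (hk : 2 ≤ k)
    (c : G.edgeSet → α) (hc : ∀ i, 301 * k * Real.logb 2 k ≤ ((c ⁻¹' {i}).ncard : ℝ)) :
    ∃ (v : V) (p : G.Walk v v),
      p.IsRainbowCycle c ∧ (p.length : ℝ) ≤ Fintype.card V / k := by
  classical
  have hV : 602 * k * Real.logb 2 k ≤ Fintype.card V := by
    linarith [two_mul_le_card_of_forall_le_ncard_fiber hα hc]
  have hedges (i : α) : 301 * k * Real.logb 2 k ≤ #(colorClass c i).edgeFinset := by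
    rw [card_edgeFinset_colorClass]
    exact hc i
  obtain ⟨S, hS, hSk, hspanned⟩ := exists_card_le_card_spannedIndices hk hα hV hedges
  have hedge_mem (i : α) (hi : i ∈ spannedIndices (colorClass c) S) :
      ∃ e : G.edgeSet, c e = i ∧ (e : Sym2 V) ∈ S.sym2 := by
    obtain ⟨u, hu, v, hv, huv⟩ := mem_spannedIndices.mp hi
    obtain ⟨e, hei, he⟩ := exists_eq_of_colorClass_adj huv
    exact ⟨e, hei, he ▸ mk_mem_sym2_iff.mpr ⟨hu, hv⟩⟩
  obtain ⟨v, p, hp, hpS⟩ := exists_isRainbowCycle_length_le_card c hS hspanned hedge_mem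
  exact ⟨v, p, hp, (Nat.cast_le.mpr hpS).trans hSk⟩

theorem theorem2p1 {V : Type*} [Fintype V] [Nonempty V] (G : SimpleGraph V) (k : ℕ) (hk : 1 < k)
    (c : G.edgeSet → Fin (Fintype.card V))
    (hc : ∀ i : Fin (Fintype.card V),
      301 * (k : ℝ) * Real.logb 2 (k : ℝ) ≤ ((c ⁻¹' {i}).ncard : ℝ)) :
    ∃ (v : V) (p : G.Walk v v),
      p.IsRainbowCycle c ∧ p.length ≤ ⌈(Fintype.card V : ℝ) / (k : ℝ)⌉₊ := by
  obtain ⟨v, p, hp, hpk⟩ :=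
    theorem2p1_general (Fintype.card_fin _).ge G (by exact_mod_cast hk : (2 : ℝ) ≤ k) c hc
  exact ⟨v, p, hp, Nat.cast_le.mp (hpk.trans (Nat.le_ceil _))⟩
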